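/- Let $\theta\colon[0,\infty)\to(-\infty,0)$ be continuous with $\frac1\theta\notin L^1(0,\infty)$, and let $L^2_{|\theta|}(0,\infty)$ be the Hilbert space of (classes of) measurable functions $x\colon[0,\infty)\to\mathbb{C}$ with $\int_0^\infty|\theta(\xi)|\,|x(\xi)|^2\,d\xi<\infty$. Put $p_\theta(\xi)=\int_0^\xi\theta(\zeta)^{-1}\,d\zeta$ for $\xi\geq0$; this is a strictly decreasing bijection $[0,\infty)\to(-\infty,0]$. For $\xi,t\geq0$ with $p_\theta(\xi)+t\leq0$ put $\mu_\theta(\xi,t)=p_\theta^{-1}(p_\theta(\xi)+t)-\xi$. Then the operator $A_\theta\colon D(A_\theta)\to L^2_{|\theta|}(0,\infty)$ given by $$A_\theta x=(\theta x)',\qquad D(A_\theta)=\bigl\{x\in L^2_{|\theta|}(0,\infty)\;:\;\theta x\in AC_{\mathrm{loc}}[0,\infty),\ (\theta x)'\in L^2_{|\theta|}(0,\infty)\text{ and }(\theta x)(0)=0\bigr\}$$ is the generator of the $C_0$-semigroup $(T_\theta(t))_{t\geq0}$ on $L^2_{|\theta|}(0,\infty)$ given, for almost every $\xi\geq 0$,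 by $$(T_\theta(t)x)(\xi)=\begin{cases}\dfrac{\theta(\xi+\mu_\theta(\xi,t))}{\theta(\xi)}\,x(\xi+\mu_\theta(\xi,t))&\text{if }p_\theta(\xi)+t\leq0,\\[2mm]0&\text{otherwise.}\end{cases}$$ Here $AC_{\mathrm{loc}}[0,\infty)$ is the set of functions that are absolutely continuous on every compact interval $[a,b]\subseteq[0,\infty)$, $\theta x\in AC_{\mathrm{loc}}[0,\infty)$ means that $\theta x$ has a representative in this set, $(\theta x)(0)$ is the value of that representative at $0$, and $(\theta x)'$ is its almost everywhere defined derivative. -/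

import Mathlib

open MeasureTheory Filter Set Topology
open scoped NNReal ENNReal

noncomputable section

/-- The measure `w(ξ) dξ` on `[0,∞)`. -/
def weightedMeasure (w : ℝ → ℝ) : Measure ℝ :=
  (volume.restrict (Ici 0)).withDensity (fun ξ => ENNReal.ofReal (w ξ))

/-- The weighted space `L²_w(0,∞)` of (classes of) complex-valued functions with
`∫₀^∞ w(ξ) |x(ξ)|² dξ < ∞`. -/
abbrev WeightedL2 (w : ℝ → ℝ) : Type := Lp ℂ 2 (weightedMeasure w)

/-- `y ∈ AC_loc(I)`: `y` is absolutely continuous on every compact interval `[a,b] ⊆ I`. -/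
def LocallyAC (y : ℝ → ℂ) (I : Set ℝ) : Prop :=
  ∀ a b : ℝ, a ≤ b → Icc a b ⊆ I → AbsolutelyContinuousOnInterval y a b

/-- A strongly continuous one-parameter semigroup of bounded operators on `X`. -/
structure C0Semigroup (X : Type*) [NormedAddCommGroup X] [NormedSpace ℂ X] where
  /-- the operators `T(t)`, `t ≥ 0` -/
  op : ℝ≥0 → X →L[ℂ] X
  op_zero : op 0 = ContinuousLinearMap.id ℂ X
  op_add : ∀ s t, op (s + t) = (op s).comp (op t)
  continuous_orbit : ∀ x, Continuous fun t => op t x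

/-- `A` is the (infinitesimal) generator of `T`: the pair `(x, y)` lies in the graph of `A`, that
is `x ∈ D(A)` and `A x = y`, if and only if `(T(t) x - x) / t → y` as `t ↘ 0`. -/
def IsGenerator {X : Type*} [NormedAddCommGroup X] [NormedSpace ℂ X]
    (A : X →ₗ.[ℂ] X) (T : C0Semigroup X) : Prop :=
  ∀ x y : X, (x, y) ∈ A.graph ↔
    Tendsto (fun t : ℝ≥0 => ((t : ℝ) : ℂ)⁻¹ • (T.op t x - x)) (𝓝[>] 0) (𝓝 y)

/-- `y` is the locally absolutely continuous representative on `[0,∞)` of `θ x`, its almost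
everywhere defined derivative belongs to `L²_{|θ|}(0,∞)`, and `y(0) = 0`. -/
structure IsTransportRep (θ : ℝ → ℝ) (x : WeightedL2 (fun ξ => |θ ξ|)) (y : ℝ → ℂ) : Prop where
  ae_eq : y =ᵐ[weightedMeasure (fun ξ => |θ ξ|)] fun ξ => (θ ξ : ℂ) * x ξ
  locallyAC : LocallyAC y (Ici 0)
  memLp_deriv : MemLp (deriv y) 2 (weightedMeasure (fun ξ => |θ ξ|))
  boundary : y 0 = 0

theorem LocallyAC.continuousOn_Ici {y : ℝ → ℂ} (h : LocallyAC y (Ici 0)) :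
    ContinuousOn y (Ici 0) := by
  intro a ha
  have ha' : (0 : ℝ) ≤ a := ha
  have h1 := (h 0 (a + 1) (by linarith) (fun z hz => hz.1)).continuousOn
  rw [uIcc_of_le (by linarith)] at h1
  refine (h1 a ⟨ha', by linarith⟩).mono_of_mem_nhdsWithin ?_
  rw [← Ici_inter_Iic]
  exact inter_mem self_mem_nhdsWithin (mem_nhdsWithin_of_mem_nhds (Iic_mem_nhds (by linarith)))

theorem LocallyAC.ae_differentiableAt {y : ℝ → ℂ} (h : LocallyAC y (Ici 0)) :
    ∀ᵐ ξ ∂(volume.restrict (Ici (0 : ℝ))), DifferentiableAt ℝ y ξ := by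
  rw [ae_restrict_iff' measurableSet_Ici]
  have h1 : ∀ n : ℕ, ∀ᵐ ξ : ℝ, ξ ∈ uIcc (0 : ℝ) n → DifferentiableAt ℝ y ξ := fun n =>
    (h 0 n (by positivity)
      (fun z hz => hz.1)).boundedVariationOn.ae_differentiableAt_of_mem_uIcc
  filter_upwards [ae_all_iff.2 h1] with ξ hξ hξ0
  obtain ⟨n, hn⟩ := exists_nat_ge ξ
  exact hξ n (by rw [uIcc_of_le (by positivity)]; exact ⟨hξ0, hn⟩)

theorem ae_weightedMeasure_of_ae {w : ℝ → ℝ} {p : ℝ → Prop}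
    (h : ∀ᵐ ξ ∂(volume.restrict (Ici (0 : ℝ))), p ξ) : ∀ᵐ ξ ∂(weightedMeasure w), p ξ :=
  (withDensity_absolutelyContinuous _ _).ae_le h

theorem ae_of_ae_weightedMeasure {θ : ℝ → ℝ} (hθ : ContinuousOn θ (Ici 0))
    (hneg : ∀ ξ, 0 ≤ ξ → θ ξ < 0) {p : ℝ → Prop}
    (h : ∀ᵐ ξ ∂(weightedMeasure fun ξ => |θ ξ|), p ξ) :
    ∀ᵐ ξ ∂(volume.restrict (Ici (0 : ℝ))), p ξ := by
  have hm : AEMeasurable (fun ξ => ENNReal.ofReal |θ ξ|) (volume.restrict (Ici (0 : ℝ))) :=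
    (hθ.abs.aemeasurable measurableSet_Ici).ennreal_ofReal
  rw [weightedMeasure, ae_withDensity_iff' hm] at h
  filter_upwards [h, ae_restrict_mem measurableSet_Ici] with ξ h1 h2
  apply h1
  have := hneg ξ h2
  simp [this.ne]

/-- The derivative does not depend on the representative. -/
theorem IsTransportRep.deriv_ae_eq {θ : ℝ → ℝ} (hθ : ContinuousOn θ (Ici 0))
    (hneg : ∀ ξ, 0 ≤ ξ → θ ξ < 0) {x : WeightedL2 (fun ξ => |θ ξ|)} {y z : ℝ → ℂ}
    (hy : IsTransportRep θ x y) (hz : IsTransportRep θ x z) :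
    deriv y =ᵐ[weightedMeasure fun ξ => |θ ξ|] deriv z := by
  have h1 : y =ᵐ[volume.restrict (Ici (0 : ℝ))] z :=
    ae_of_ae_weightedMeasure hθ hneg (hy.ae_eq.trans hz.ae_eq.symm)
  have h2 : EqOn y z (Ici 0) :=
    Measure.eqOn_of_ae_eq h1 hy.locallyAC.continuousOn_Ici hz.locallyAC.continuousOn_Ici
      (by simp)
  apply ae_weightedMeasure_of_ae
  have h3 : ∀ᵐ ξ ∂(volume.restrict (Ici (0 : ℝ))), ξ ≠ 0 :=
    ae_restrict_of_ae (by simp [ae_iff, measure_singleton])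
  filter_upwards [h3, ae_restrict_mem measurableSet_Ici] with ξ h4 h5
  have h6 : (0 : ℝ) < ξ := lt_of_le_of_ne h5 (Ne.symm h4)
  exact EventuallyEq.deriv_eq (eventually_of_mem (Ioi_mem_nhds h6) fun η hη => h2 (mem_Ici.2 (le_of_lt hη)))

theorem IsTransportRep.deriv_add_ae {θ : ℝ → ℝ} {x₁ x₂ : WeightedL2 (fun ξ => |θ ξ|)}
    {y₁ y₂ : ℝ → ℂ} (h₁ : IsTransportRep θ x₁ y₁) (h₂ : IsTransportRep θ x₂ y₂) :
    deriv (y₁ + y₂) =ᵐ[weightedMeasure fun ξ => |θ ξ|] deriv y₁ + deriv y₂ := by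
  apply ae_weightedMeasure_of_ae
  filter_upwards [h₁.locallyAC.ae_differentiableAt, h₂.locallyAC.ae_differentiableAt] with ξ a b
  simpa using deriv_add a b

theorem deriv_const_smul_fun (c : ℂ) (y : ℝ → ℂ) : deriv (c • y) = c • deriv y := by
  funext ξ
  rw [Pi.smul_apply]
  exact deriv_const_smul_field c y

theorem IsTransportRep.add {θ : ℝ → ℝ} {x₁ x₂ : WeightedL2 (fun ξ => |θ ξ|)} {y₁ y₂ : ℝ → ℂ}
    (h₁ : IsTransportRep θ x₁ y₁) (h₂ : IsTransportRep θ x₂ y₂) :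
    IsTransportRep θ (x₁ + x₂) (y₁ + y₂) where
  ae_eq := by
    filter_upwards [h₁.ae_eq, h₂.ae_eq, Lp.coeFn_add x₁ x₂] with ξ a b c
    simp only [Pi.add_apply, a, b, c]
    ring
  locallyAC := fun a b hab hI => (h₁.locallyAC a b hab hI).add (h₂.locallyAC a b hab hI)
  memLp_deriv :=
    (memLp_congr_ae (h₁.deriv_add_ae h₂)).2 (h₁.memLp_deriv.add h₂.memLp_deriv)
  boundary := by simp [h₁.boundary, h₂.boundary]

theorem IsTransportRep.smul {θ : ℝ → ℝ} {x : WeightedL2 (fun ξ => |θ ξ|)} {y : ℝ → ℂ} (c : ℂ)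
    (h : IsTransportRep θ x y) : IsTransportRep θ (c • x) (c • y) where
  ae_eq := by
    filter_upwards [h.ae_eq, Lp.coeFn_smul c x] with ξ a b
    simp only [Pi.smul_apply, a, b, smul_eq_mul]
    ring
  locallyAC := fun a b hab hI => (h.locallyAC a b hab hI).const_smul c
  memLp_deriv := by
    rw [deriv_const_smul_fun]
    exact h.memLp_deriv.const_smul c
  boundary := by simp [h.boundary]

theorem IsTransportRep.zero (θ : ℝ → ℝ) : IsTransportRep θ 0 0 where
  ae_eq := by
    filter_upwards [Lp.coeFn_zero ℂ 2 (weightedMeasure fun ξ => |θ ξ|)] with ξ a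
    rw [a]
    simp
  locallyAC := fun a b _ _ => by
    simpa [AbsolutelyContinuousOnInterval] using tendsto_const_nhds
  memLp_deriv := by
    have : deriv (0 : ℝ → ℂ) = 0 := by funext ξ; simp
    rw [this]
    exact MemLp.zero
  boundary := rfl

/-- The domain `D(A_θ)`: all `x ∈ L²_{|θ|}(0,∞)` with `θx ∈ AC_loc[0,∞)`,
`(θx)' ∈ L²_{|θ|}(0,∞)` and `(θx)(0) = 0`. -/
def transportDomain (θ : ℝ → ℝ) : Submodule ℂ (WeightedL2 (fun ξ => |θ ξ|)) where
  carrier := {x | ∃ y, IsTransportRep θ x y}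
  add_mem' := fun ⟨_, h₁⟩ ⟨_, h₂⟩ => ⟨_, h₁.add h₂⟩
  zero_mem' := ⟨_, IsTransportRep.zero θ⟩
  smul_mem' := fun c _ ⟨_, h⟩ => ⟨_, h.smul c⟩

/-- The operator `A_θ x = (θx)'` on `L²_{|θ|}(0,∞)` with domain `D(A_θ)`, for a continuous and
strictly negative `θ` on `[0,∞)`. -/
def transportOperator (θ : ℝ → ℝ) (hθ : ContinuousOn θ (Ici 0))
    (hneg : ∀ ξ, 0 ≤ ξ → θ ξ < 0) :
    WeightedL2 (fun ξ => |θ ξ|) →ₗ.[ℂ] WeightedL2 (fun ξ => |θ ξ|) where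
  domain := transportDomain θ
  toFun :=
    { toFun := fun x => (Classical.choose_spec x.2).memLp_deriv.toLp _
      map_add' := fun x₁ x₂ => by
        rw [← MemLp.toLp_add]
        refine MemLp.toLp_congr _ _ ?_
        exact (IsTransportRep.deriv_ae_eq hθ hneg (Classical.choose_spec (x₁ + x₂).2)
          ((Classical.choose_spec x₁.2).add (Classical.choose_spec x₂.2))).trans
          (IsTransportRep.deriv_add_ae (Classical.choose_spec x₁.2) (Classical.choose_spec x₂.2))
      map_smul' := fun c x => by
        rw [RingHom.id_apply, ← MemLp.toLp_const_smul]
        refine MemLp.toLp_congr _ _ ?_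
        rw [← deriv_const_smul_fun]
        exact IsTransportRep.deriv_ae_eq hθ hneg (Classical.choose_spec (c • x).2)
          ((Classical.choose_spec x.2).smul c) }

/-- `p_θ(ξ) = ∫₀^ξ θ(ζ)⁻¹ dζ`. -/
def travelTime (θ : ℝ → ℝ) (ξ : ℝ) : ℝ := ∫ ζ in (0 : ℝ)..ξ, (θ ζ)⁻¹

/-- `p_θ⁻¹ : p_θ([0,∞)) → [0,∞)`, the inverse of `p_θ` on `[0,∞)`. It is only meaningful for
arguments in the range `p_θ([0,∞))`. -/
def travelTimeInv (θ : ℝ → ℝ) : ℝ → ℝ := Function.invFunOn (travelTime θ) (Ici 0)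

/-- `μ_θ(ξ,t) = p_θ⁻¹(p_θ(ξ) + t) - ξ`. -/
def displacement (θ : ℝ → ℝ) (ξ t : ℝ) : ℝ := travelTimeInv θ (travelTime θ ξ + t) - ξ

open scoped Classical in
/-- The weighted shift. The characteristic `ξ + μ_θ(ξ,t) = p_θ⁻¹(p_θ(ξ) + t)` stays in `[0,∞)`
exactly when `p_θ(ξ) + t` lies in the range `p_θ([0,∞))`; otherwise the value is `0`. -/
def weightedShift (θ : ℝ → ℝ) (t : ℝ) (x : ℝ → ℂ) (ξ : ℝ) : ℂ :=
  if travelTime θ ξ + t ∈ travelTime θ '' Ici 0 then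
    ((θ (ξ + displacement θ ξ t) / θ ξ : ℝ) : ℂ) * x (ξ + displacement θ ξ t)
  else 0

end

/-!
In the time coordinate `s = p_θ(ξ) ≤ 0` the flux `θ x` defines an isometry `J` of `L²_{|θ|}(0,∞)`
onto `L²(p_θ([0,∞)))`, and `T_θ(t)` becomes the left translation by `t`, with zero inflow from
`s > 0`. Hence `∫_a^0 J T_θ(t) x = ∫_{a+t}^0 J x`. If `(T_θ(t) x - x) / t → z`, Lebesgue
differentiation of this identity at `t = 0` gives `J x (a) = ∫_0^a J z` for almost every `a`.
Conversely, this formula implies `T_θ(t) x - x = ∫_0^t T_θ(r) z dr`, since both sides have the same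
integrals `∫_a^0` in the time coordinate; so the difference quotients are averages of a continuous
orbit and converge to `z`. Back in `ξ` the formula reads `(θ x)(ξ) = ∫_0^ξ z`, which describes the
graph of `A_θ`.
-/

noncomputable section

section LpMap

variable {α β 𝕜 E F : Type*} [MeasurableSpace α] [MeasurableSpace β] [NormedField 𝕜]
  [NormedAddCommGroup E] [NormedAddCommGroup F] [NormedSpace 𝕜 E] [NormedSpace 𝕜 F]
  {μ : Measure α} {ν : Measure β} {p : ℝ≥0∞}

theorem aestronglyMeasurable_comp_of_tendsto_ae {γ : Type*} [TopologicalSpace γ] {f : α → β}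
    {g : β → γ} (hf : AEMeasurable f μ) (hae : Tendsto f (ae μ) (ae ν))
    (hg : AEStronglyMeasurable g ν) :
    AEStronglyMeasurable (g ∘ f) μ :=
  (hg.stronglyMeasurable_mk.aestronglyMeasurable.comp_aemeasurable hf).congr
    (EventuallyEq.symm (hae.eventually hg.ae_eq_mk))

theorem ae_eq_of_eLpNorm_map_le {Φ : (α → E) →ₗ[𝕜] (β → F)} (hp : p ≠ 0)
    (hmeas : ∀ f, AEStronglyMeasurable f μ → AEStronglyMeasurable (Φ f) ν)
    (hnorm : ∀ f, eLpNorm (Φ f) p ν ≤ eLpNorm f p μ) {f g : α → E} (hfg : f =ᵐ[μ] g) :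
    Φ f =ᵐ[ν] Φ g := by
  have hsub : f - g =ᵐ[μ] 0 := by
    filter_upwards [hfg] with a ha
    simp [ha]
  have hzero : eLpNorm (Φ (f - g)) p ν = 0 :=
    le_antisymm ((hnorm _).trans_eq (by rw [eLpNorm_congr_ae hsub, eLpNorm_zero])) zero_le
  have hmeas_sub : AEStronglyMeasurable (Φ (f - g)) ν :=
    hmeas _ (aestronglyMeasurable_zero.congr hsub.symm)
  filter_upwards [(eLpNorm_eq_zero_iff hmeas_sub hp).1 hzero] with b hb
  simpa [sub_eq_zero] using hb

theorem memLp_map_of_eLpNorm_map_le {Φ : (α → E) →ₗ[𝕜] (β → F)}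
    (hmeas : ∀ f, AEStronglyMeasurable f μ → AEStronglyMeasurable (Φ f) ν)
    (hnorm : ∀ f, eLpNorm (Φ f) p ν ≤ eLpNorm f p μ) {f : α → E} (hf : MemLp f p μ) :
    MemLp (Φ f) p ν :=
  ⟨hmeas f hf.1, (hnorm f).trans_lt hf.2⟩

/-- The bounded operator `Lp → Lp` induced by a linear map of functions that preserves almost
everywhere strong measurability and does not increase the `Lp` seminorm. -/
def lpMap [Fact (1 ≤ p)] (Φ : (α → E) →ₗ[𝕜] (β → F))
    (hmeas : ∀ f, AEStronglyMeasurable f μ → AEStronglyMeasurable (Φ f) ν)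
    (hnorm : ∀ f, eLpNorm (Φ f) p ν ≤ eLpNorm f p μ) : Lp E p μ →L[𝕜] Lp F p ν :=
  have hcongr {f g : α → E} (hfg : f =ᵐ[μ] g) : Φ f =ᵐ[ν] Φ g :=
    ae_eq_of_eLpNorm_map_le (zero_lt_one.trans_le Fact.out).ne' hmeas hnorm hfg
  LinearMap.mkContinuous
    { toFun := fun x => (memLp_map_of_eLpNorm_map_le hmeas hnorm (Lp.memLp x)).toLp _
      map_add' := fun x y => by
        rw [← MemLp.toLp_add]
        exact MemLp.toLp_congr _ _ ((hcongr (Lp.coeFn_add x y)).trans (by rw [map_add]))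
      map_smul' := fun c x => by
        rw [RingHom.id_apply, ← MemLp.toLp_const_smul]
        exact MemLp.toLp_congr _ _ ((hcongr (Lp.coeFn_smul c x)).trans (by rw [map_smul])) }
    1 fun x => by
      rw [one_mul, LinearMap.coe_mk, AddHom.coe_mk, Lp.norm_toLp]
      exact ENNReal.toReal_mono (Lp.eLpNorm_ne_top x) (hnorm x)

theorem coeFn_lpMap [Fact (1 ≤ p)] {Φ : (α → E) →ₗ[𝕜] (β → F)}
    (hmeas : ∀ f, AEStronglyMeasurable f μ → AEStronglyMeasurable (Φ f) ν)
    (hnorm : ∀ f, eLpNorm (Φ f) p ν ≤ eLpNorm f p μ) {x : Lp E p μ} {f : α → E}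
    (hf : x =ᵐ[μ] f) : lpMap Φ hmeas hnorm x =ᵐ[ν] Φ f :=
  (memLp_map_of_eLpNorm_map_le hmeas hnorm (Lp.memLp x)).coeFn_toLp.trans
    (ae_eq_of_eLpNorm_map_le (zero_lt_one.trans_le Fact.out).ne' hmeas hnorm hf)

end LpMap

/-- The standing assumptions on the transport speed: continuity and strict negativity on `[0,∞)`.
Nothing is required of the values at negative arguments. -/
structure IsTransportSpeed (θ : ℝ → ℝ) : Prop where
  continuousOn : ContinuousOn θ (Ici 0)
  neg : ∀ ξ, 0 ≤ ξ → θ ξ < 0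

/-- The range `p_θ([0,∞)) ⊆ (-∞,0]` of the travel time. -/
abbrev travelRange (θ : ℝ → ℝ) : Set ℝ := travelTime θ '' Ici 0

theorem travelTime_zero (θ : ℝ → ℝ) : travelTime θ 0 = 0 := intervalIntegral.integral_same

theorem zero_mem_travelRange (θ : ℝ → ℝ) : 0 ∈ travelRange θ :=
  ⟨0, mem_Ici.2 le_rfl, travelTime_zero θ⟩

theorem travelTime_mem_travelRange (θ : ℝ → ℝ) {ξ : ℝ} (hξ : 0 ≤ ξ) :
    travelTime θ ξ ∈ travelRange θ :=
  mem_image_of_mem _ hξ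

theorem travelTimeInv_nonneg {θ : ℝ → ℝ} {s : ℝ} (hs : s ∈ travelRange θ) :
    0 ≤ travelTimeInv θ s :=
  Function.invFunOn_mem hs

theorem travelTime_travelTimeInv {θ : ℝ → ℝ} {s : ℝ} (hs : s ∈ travelRange θ) :
    travelTime θ (travelTimeInv θ s) = s :=
  Function.invFunOn_eq hs

namespace IsTransportSpeed

variable {θ : ℝ → ℝ}

theorem inv (h : IsTransportSpeed θ) : IsTransportSpeed fun ξ => (θ ξ)⁻¹ :=
  ⟨h.continuousOn.inv₀ fun ξ hξ => (h.neg ξ hξ).ne, fun ξ hξ => inv_lt_zero.2 (h.neg ξ hξ)⟩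

theorem hasDerivWithinAt_travelTime (h : IsTransportSpeed θ) {ξ : ℝ} (hξ : ξ ∈ Ici 0) :
    HasDerivWithinAt (travelTime θ) (θ ξ)⁻¹ (Ici 0) ξ := by
  have hcont : Continuous fun ζ => (θ (max ζ 0))⁻¹ :=
    h.inv.continuousOn.comp_continuous (by fun_prop) fun ζ => le_max_right ζ 0
  have heq : EqOn (travelTime θ) (fun η => ∫ ζ in 0..η, (θ (max ζ 0))⁻¹) (Ici 0) :=
    fun η hη => intervalIntegral.integral_congr fun ζ hζ => by
      rw [uIcc_of_le (mem_Ici.1 hη)] at hζ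
      simp only [max_eq_left hζ.1]
  simpa [max_eq_left (mem_Ici.1 hξ)] using
    ((hcont.integral_hasStrictDerivAt 0 ξ).hasDerivAt.hasDerivWithinAt (s := Ici 0)).congr heq
      (heq hξ)

theorem continuousOn_travelTime (h : IsTransportSpeed θ) :
    ContinuousOn (travelTime θ) (Ici 0) :=
  fun _ hξ => (h.hasDerivWithinAt_travelTime hξ).continuousWithinAt

theorem strictAntiOn_travelTime (h : IsTransportSpeed θ) :
    StrictAntiOn (travelTime θ) (Ici 0) :=
  strictAntiOn_of_hasDerivWithinAt_neg (convex_Ici 0) h.continuousOn_travelTime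
    (fun _ hξ => (h.hasDerivWithinAt_travelTime (interior_subset hξ)).mono interior_subset)
    fun ξ hξ => h.inv.neg ξ (interior_subset hξ)

theorem travelTimeInv_travelTime (h : IsTransportSpeed θ) {ξ : ℝ} (hξ : 0 ≤ ξ) :
    travelTimeInv θ (travelTime θ ξ) = ξ :=
  h.strictAntiOn_travelTime.injOn.leftInvOn_invFunOn hξ

theorem antitoneOn_travelTimeInv (h : IsTransportSpeed θ) :
    AntitoneOn (travelTimeInv θ) (travelRange θ) := by
  rintro _ ⟨ξ, hξ, rfl⟩ _ ⟨η, hη, rfl⟩ hle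
  rw [h.travelTimeInv_travelTime hξ, h.travelTimeInv_travelTime hη]
  exact (h.strictAntiOn_travelTime.le_iff_ge hξ hη).1 hle

theorem ordConnected_travelRange (h : IsTransportSpeed θ) : (travelRange θ).OrdConnected :=
  (isPreconnected_Ici.image _ h.continuousOn_travelTime).ordConnected

theorem add_notMem_travelRange (h : IsTransportSpeed θ) {ξ s t : ℝ} (hξ : 0 ≤ ξ)
    (hle : travelTime θ ξ ≤ s) (hs : s ∉ travelRange θ) (ht : 0 ≤ t) : s + t ∉ travelRange θ :=
  fun hst => hs (h.ordConnected_travelRange.out (travelTime_mem_travelRange θ hξ) hst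
    ⟨hle, le_add_of_nonneg_right ht⟩)

theorem image_travelTime_Icc (h : IsTransportSpeed θ) {ξ : ℝ} (hξ : 0 ≤ ξ) :
    travelTime θ '' Icc 0 ξ = Icc (travelTime θ ξ) 0 := by
  rw [(h.continuousOn_travelTime.mono Icc_subset_Ici_self).image_Icc_of_antitoneOn hξ
    (h.strictAntiOn_travelTime.antitoneOn.mono Icc_subset_Ici_self), travelTime_zero]

theorem travelRange_subset_Iic (h : IsTransportSpeed θ) : travelRange θ ⊆ Iic 0 := by
  rintro _ ⟨ξ, hξ, rfl⟩
  exact travelTime_zero θ ▸ h.strictAntiOn_travelTime.antitoneOn self_mem_Ici hξ hξ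

theorem Icc_subset_travelRange (h : IsTransportSpeed θ) {a : ℝ} (ha : a ∈ travelRange θ) :
    Icc a 0 ⊆ travelRange θ :=
  h.ordConnected_travelRange.out ha (zero_mem_travelRange θ)

theorem measurableSet_travelRange (h : IsTransportSpeed θ) : MeasurableSet (travelRange θ) :=
  h.ordConnected_travelRange.measurableSet

end IsTransportSpeed

theorem ae_weightedMeasure_nonneg (w : ℝ → ℝ) : ∀ᵐ ξ ∂weightedMeasure w, 0 ≤ ξ :=
  ae_weightedMeasure_of_ae (ae_restrict_mem measurableSet_Ici)

namespace IsTransportSpeed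

variable {θ : ℝ → ℝ}

theorem aemeasurable_travelTime (h : IsTransportSpeed θ) (w : ℝ → ℝ) :
    AEMeasurable (travelTime θ) (weightedMeasure w) :=
  (h.continuousOn_travelTime.aemeasurable measurableSet_Ici).mono_ac
    (withDensity_absolutelyContinuous _ _)

theorem tendsto_travelTime_ae (h : IsTransportSpeed θ) :
    Tendsto (travelTime θ) (ae (weightedMeasure fun ξ => |θ ξ|))
      (ae (volume.restrict (travelRange θ))) := by
  intro P hP
  have hmap := map_withDensity_abs_det_fderiv_eq_addHaar volume
    measurableSet_Ici.nullMeasurableSet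
    (fun ξ hξ => (h.hasDerivWithinAt_travelTime hξ).hasFDerivWithinAt)
    h.strictAntiOn_travelTime.injOn
  simp only [ContinuousLinearMap.det_toSpanSingleton] at hmap
  refine ae_weightedMeasure_of_ae
    (ae_of_ae_weightedMeasure h.inv.continuousOn h.inv.neg
      (ae_of_ae_map (h.aemeasurable_travelTime _) ?_))
  rw [weightedMeasure, hmap]
  exact hP

theorem tendsto_travelTimeInv_ae (h : IsTransportSpeed θ) :
    Tendsto (travelTimeInv θ) (ae (volume.restrict (travelRange θ)))
      (ae (weightedMeasure fun ξ => |θ ξ|)) := by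
  intro P hP
  have hnull : volume {ξ | ¬(ξ ∈ Ici 0 → ξ ∈ P)} = 0 :=
    (ae_restrict_iff' measurableSet_Ici).1 (ae_of_ae_weightedMeasure h.continuousOn h.neg hP)
  have hdiff : DifferentiableOn ℝ (travelTime θ) {ξ | ¬(ξ ∈ Ici 0 → ξ ∈ P)} := fun ξ hξ =>
    ((h.hasDerivWithinAt_travelTime (Classical.not_imp.1 hξ).1).mono
      fun _ hη => (Classical.not_imp.1 hη).1).differentiableWithinAt
  refine (ae_restrict_iff' h.measurableSet_travelRange).2 (measure_mono_null ?_
    (addHaar_image_eq_zero_of_differentiableOn_of_addHaar_eq_zero volume hdiff hnull))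
  intro s hs
  obtain ⟨hsI, hsP⟩ := Classical.not_imp.1 hs
  exact ⟨travelTimeInv θ s, Classical.not_imp.2 ⟨travelTimeInv_nonneg hsI, hsP⟩,
    travelTime_travelTimeInv hsI⟩

theorem ae_travelRange_iff (h : IsTransportSpeed θ) {P : ℝ → Prop} :
    (∀ᵐ s ∂volume.restrict (travelRange θ), P s) ↔
      ∀ᵐ ξ ∂weightedMeasure fun ξ => |θ ξ|, P (travelTime θ ξ) := by
  refine ⟨h.tendsto_travelTime_ae.eventually, fun hP => ?_⟩
  filter_upwards [h.tendsto_travelTimeInv_ae.eventually hP,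
    ae_restrict_mem h.measurableSet_travelRange] with s hs hsI
  rwa [travelTime_travelTimeInv hsI] at hs

theorem lintegral_travelRange (h : IsTransportSpeed θ) (G : ℝ → ℝ≥0∞) :
    ∫⁻ s in travelRange θ, G s =
      ∫⁻ ξ in Ici 0, ENNReal.ofReal |(θ ξ)⁻¹| * G (travelTime θ ξ) :=
  lintegral_image_eq_lintegral_abs_deriv_mul measurableSet_Ici
    (fun _ => h.hasDerivWithinAt_travelTime) h.strictAntiOn_travelTime.injOn G

end IsTransportSpeed

/-- The flux `θ x` in the time coordinate `s = p_θ(ξ)`, extended by zero to the whole line. In this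
coordinate the transport semigroup is the left translation. -/
def toTime (θ : ℝ → ℝ) : (ℝ → ℂ) →ₗ[ℂ] (ℝ → ℂ) where
  toFun f := (travelRange θ).indicator fun s => θ (travelTimeInv θ s) * f (travelTimeInv θ s)
  map_add' f g := by
    simp only [Pi.add_apply, mul_add]
    exact indicator_add _ _ _
  map_smul' c f := by
    simp only [Pi.smul_apply, smul_eq_mul, mul_left_comm _ c]
    exact indicator_const_smul _ c _

/-- The left inverse of `toTime θ`: the function on `[0,∞)` whose flux is `g` in the time
coordinate. -/
def ofTime (θ : ℝ → ℝ) : (ℝ → ℂ) →ₗ[ℂ] (ℝ → ℂ) where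
  toFun g ξ := (θ ξ : ℂ)⁻¹ * g (travelTime θ ξ)
  map_add' _ _ := by
    ext ξ
    exact mul_add _ _ _
  map_smul' _ _ := by
    ext ξ
    exact mul_left_comm _ _ _

theorem ofTime_apply (θ : ℝ → ℝ) (g : ℝ → ℂ) (ξ : ℝ) :
    ofTime θ g ξ = (θ ξ : ℂ)⁻¹ * g (travelTime θ ξ) := rfl

theorem toTime_of_notMem {θ : ℝ → ℝ} (f : ℝ → ℂ) {s : ℝ} (hs : s ∉ travelRange θ) :
    toTime θ f s = 0 := by
  rw [toTime, LinearMap.coe_mk, AddHom.coe_mk, indicator_of_notMem hs]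

theorem toTime_of_mem {θ : ℝ → ℝ} (f : ℝ → ℂ) {s : ℝ} (hs : s ∈ travelRange θ) :
    toTime θ f s = θ (travelTimeInv θ s) * f (travelTimeInv θ s) := by
  rw [toTime, LinearMap.coe_mk, AddHom.coe_mk, indicator_of_mem hs]

theorem weightedShift_eq_ofTime_toTime (θ : ℝ → ℝ) (t : ℝ) (f : ℝ → ℂ) :
    weightedShift θ t f = ofTime θ fun s => toTime θ f (s + t) := by
  ext ξ
  have hflow : ξ + displacement θ ξ t = travelTimeInv θ (travelTime θ ξ + t) :=
    add_sub_cancel _ _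
  by_cases hξ : travelTime θ ξ + t ∈ travelRange θ
  · rw [weightedShift, if_pos hξ, ofTime_apply, toTime_of_mem f hξ, hflow, Complex.ofReal_div]
    ring
  · rw [weightedShift, if_neg hξ, ofTime_apply, toTime_of_notMem f hξ, mul_zero]

namespace IsTransportSpeed

variable {θ : ℝ → ℝ}

theorem toTime_travelTime (h : IsTransportSpeed θ) (f : ℝ → ℂ) {ξ : ℝ} (hξ : 0 ≤ ξ) :
    toTime θ f (travelTime θ ξ) = θ ξ * f ξ := by
  rw [toTime_of_mem f (travelTime_mem_travelRange θ hξ), h.travelTimeInv_travelTime hξ]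

theorem ofTime_toTime (h : IsTransportSpeed θ) (f : ℝ → ℂ) {ξ : ℝ} (hξ : 0 ≤ ξ) :
    ofTime θ (toTime θ f) ξ = f ξ := by
  have hne : (θ ξ : ℂ) ≠ 0 := Complex.ofReal_ne_zero.2 (h.neg ξ hξ).ne
  rw [ofTime_apply, h.toTime_travelTime f hξ, inv_mul_cancel_left₀ hne]

theorem toTime_ofTime (h : IsTransportSpeed θ) (g : ℝ → ℂ) :
    toTime θ (ofTime θ g) = (travelRange θ).indicator g := by
  ext s
  by_cases hs : s ∈ travelRange θ
  · have hne : (θ (travelTimeInv θ s) : ℂ) ≠ 0 :=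
      Complex.ofReal_ne_zero.2 (h.neg _ (travelTimeInv_nonneg hs)).ne
    rw [toTime_of_mem _ hs, indicator_of_mem hs, ofTime_apply, mul_inv_cancel_left₀ hne,
      travelTime_travelTimeInv hs]
  · rw [toTime_of_notMem _ hs, indicator_of_notMem hs]

theorem eLpNorm_ofTime (h : IsTransportSpeed θ) (g : ℝ → ℂ) :
    eLpNorm (ofTime θ g) 2 (weightedMeasure fun ξ => |θ ξ|) =
      eLpNorm g 2 (volume.restrict (travelRange θ)) := by
  have hmeas : AEMeasurable (fun ξ => ENNReal.ofReal |θ ξ|) (volume.restrict (Ici 0)) :=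
    (h.continuousOn.abs.aemeasurable measurableSet_Ici).ennreal_ofReal
  have hsq : ∫⁻ ξ, ‖ofTime θ g ξ‖ₑ ^ (2 : ℝ) ∂weightedMeasure (fun ξ => |θ ξ|) =
      ∫⁻ s in travelRange θ, ‖g s‖ₑ ^ (2 : ℝ) := by
    rw [h.lintegral_travelRange, weightedMeasure,
      lintegral_withDensity_eq_lintegral_mul_non_measurable₀ _ hmeas (by simp)]
    refine setLIntegral_congr_fun measurableSet_Ici fun ξ hξ => ?_
    have hpos : |θ ξ| ≠ 0 := abs_ne_zero.2 (h.neg ξ hξ).ne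
    simp only [Pi.mul_apply, ofTime_apply, enorm_mul, ENNReal.rpow_ofNat, mul_pow, ← mul_assoc]
    congr 1
    rw [← Complex.ofReal_inv, ← ofReal_norm, Complex.norm_real, Real.norm_eq_abs,
      ← ENNReal.ofReal_pow (abs_nonneg _), ← ENNReal.ofReal_mul (abs_nonneg _), abs_inv]
    congr 1
    field_simp
  rw [eLpNorm_eq_lintegral_rpow_enorm_toReal two_ne_zero ENNReal.ofNat_ne_top,
    eLpNorm_eq_lintegral_rpow_enorm_toReal two_ne_zero ENNReal.ofNat_ne_top, ENNReal.toReal_ofNat,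
    hsq]

theorem eLpNorm_toTime (h : IsTransportSpeed θ) (f : ℝ → ℂ) :
    eLpNorm (toTime θ f) 2 volume = eLpNorm f 2 (weightedMeasure fun ξ => |θ ξ|) := by
  have hinv : ofTime θ (toTime θ f) =ᵐ[weightedMeasure fun ξ => |θ ξ|] f := by
    filter_upwards [ae_weightedMeasure_nonneg _] with ξ hξ using h.ofTime_toTime f hξ
  rw [← eLpNorm_congr_ae hinv, h.eLpNorm_ofTime,
    ← eLpNorm_indicator_eq_eLpNorm_restrict h.measurableSet_travelRange]
  congr 1
  exact (indicator_eq_self.2 fun s hs => by_contra fun hsI => hs (toTime_of_notMem f hsI)).symm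

theorem aestronglyMeasurable_ofTime (h : IsTransportSpeed θ) {g : ℝ → ℂ}
    (hg : AEStronglyMeasurable g volume) :
    AEStronglyMeasurable (ofTime θ g) (weightedMeasure fun ξ => |θ ξ|) := by
  have hinv : AEStronglyMeasurable (fun ξ => (θ ξ)⁻¹) (weightedMeasure fun ξ => |θ ξ|) :=
    (h.inv.continuousOn.aestronglyMeasurable measurableSet_Ici).mono_ac
      (withDensity_absolutelyContinuous _ _)
  have hcomp := aestronglyMeasurable_comp_of_tendsto_ae (h.aemeasurable_travelTime _)
    h.tendsto_travelTime_ae hg.restrict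
  refine ((Complex.continuous_ofReal.comp_aestronglyMeasurable hinv).mul hcomp).congr
    (.of_forall fun ξ => ?_)
  simp [ofTime_apply]

theorem aestronglyMeasurable_toTime (h : IsTransportSpeed θ) {f : ℝ → ℂ}
    (hf : AEStronglyMeasurable f (weightedMeasure fun ξ => |θ ξ|)) :
    AEStronglyMeasurable (toTime θ f) volume := by
  have hθ : AEStronglyMeasurable θ (weightedMeasure fun ξ => |θ ξ|) :=
    (h.continuousOn.aestronglyMeasurable measurableSet_Ici).mono_ac
      (withDensity_absolutelyContinuous _ _)
  have hq := aemeasurable_restrict_of_antitoneOn (μ := volume) h.measurableSet_travelRange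
    h.antitoneOn_travelTimeInv
  exact (aestronglyMeasurable_indicator_iff h.measurableSet_travelRange).2
    (aestronglyMeasurable_comp_of_tendsto_ae hq h.tendsto_travelTimeInv_ae
      ((Complex.continuous_ofReal.comp_aestronglyMeasurable hθ).mul hf))

/-- The operator from `L²_{|θ|}(0,∞)` to `L²(ℝ)` given by `toTime θ`. -/
def toTimeLp (h : IsTransportSpeed θ) :
    WeightedL2 (fun ξ => |θ ξ|) →L[ℂ] Lp ℂ 2 (volume : Measure ℝ) :=
  lpMap (toTime θ) (fun _ => h.aestronglyMeasurable_toTime) fun f => (h.eLpNorm_toTime f).le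

/-- The left inverse of `toTimeLp` given by `ofTime θ`. -/
def ofTimeLp (h : IsTransportSpeed θ) :
    Lp ℂ 2 (volume : Measure ℝ) →L[ℂ] WeightedL2 (fun ξ => |θ ξ|) :=
  lpMap (ofTime θ) (fun _ => h.aestronglyMeasurable_ofTime) fun g =>
    (h.eLpNorm_ofTime g).trans_le (eLpNorm_mono_measure g Measure.restrict_le_self)

theorem coeFn_toTimeLp (h : IsTransportSpeed θ) {x : WeightedL2 (fun ξ => |θ ξ|)} {f : ℝ → ℂ}
    (hf : x =ᵐ[weightedMeasure fun ξ => |θ ξ|] f) : h.toTimeLp x =ᵐ[volume] toTime θ f :=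
  coeFn_lpMap _ _ hf

theorem coeFn_ofTimeLp (h : IsTransportSpeed θ) {g : Lp ℂ 2 (volume : Measure ℝ)} {k : ℝ → ℂ}
    (hk : g =ᵐ[volume] k) : h.ofTimeLp g =ᵐ[weightedMeasure fun ξ => |θ ξ|] ofTime θ k :=
  coeFn_lpMap _ _ hk

end IsTransportSpeed

/-- Left translation `g ↦ g(· + t)` on `L²(ℝ)`. -/
def leftTranslation (t : ℝ) : Lp ℂ 2 (volume : Measure ℝ) →ₗᵢ[ℂ] Lp ℂ 2 (volume : Measure ℝ) :=
  Lp.compMeasurePreservingₗᵢ ℂ (fun s => s + t) (measurePreserving_add_right volume t)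

theorem coeFn_leftTranslation (t : ℝ) {g : Lp ℂ 2 (volume : Measure ℝ)} {k : ℝ → ℂ}
    (hk : g =ᵐ[volume] k) : leftTranslation t g =ᵐ[volume] fun s => k (s + t) :=
  (Lp.coeFn_compMeasurePreserving g (measurePreserving_add_right volume t)).trans
    ((measurePreserving_add_right volume t).quasiMeasurePreserving.ae_eq_comp hk)

theorem continuous_leftTranslation (g : Lp ℂ 2 (volume : Measure ℝ)) :
    Continuous fun t => leftTranslation t g := by
  let shift : C(ℝ, C(ℝ, ℝ)) := (ContinuousMap.mk (fun a : ℝ × ℝ => a.2 + a.1)).curry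
  exact (continuous_const (y := g)).compMeasurePreservingLp shift.continuous
    (fun t => measurePreserving_add_right volume t) ENNReal.ofNat_ne_top

namespace IsTransportSpeed

variable {θ : ℝ → ℝ}

theorem weightedShift_zero (h : IsTransportSpeed θ) (f : ℝ → ℂ) {ξ : ℝ} (hξ : 0 ≤ ξ) :
    weightedShift θ 0 f ξ = f ξ := by
  simp only [weightedShift_eq_ofTime_toTime, add_zero, h.ofTime_toTime f hξ]

theorem weightedShift_add (h : IsTransportSpeed θ) {s t : ℝ} (hs : 0 ≤ s) (ht : 0 ≤ t)
    (f : ℝ → ℂ) {ξ : ℝ} (hξ : 0 ≤ ξ) :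
    weightedShift θ (s + t) f ξ = weightedShift θ s (weightedShift θ t f) ξ := by
  simp only [weightedShift_eq_ofTime_toTime, h.toTime_ofTime, ofTime_apply, ← add_assoc]
  by_cases hsI : travelTime θ ξ + s ∈ travelRange θ
  · rw [indicator_of_mem hsI]
  · rw [indicator_of_notMem hsI, toTime_of_notMem f
      (h.add_notMem_travelRange hξ (le_add_of_nonneg_right hs) hsI ht)]

/-- The operators `T_θ(t)`: left translation in the time coordinate. -/
def shiftLp (h : IsTransportSpeed θ) (t : ℝ≥0) :
    WeightedL2 (fun ξ => |θ ξ|) →L[ℂ] WeightedL2 (fun ξ => |θ ξ|) :=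
  h.ofTimeLp ∘L (leftTranslation t).toContinuousLinearMap ∘L h.toTimeLp

theorem coeFn_shiftLp (h : IsTransportSpeed θ) (t : ℝ≥0) {x : WeightedL2 (fun ξ => |θ ξ|)}
    {f : ℝ → ℂ} (hf : x =ᵐ[weightedMeasure fun ξ => |θ ξ|] f) :
    h.shiftLp t x =ᵐ[weightedMeasure fun ξ => |θ ξ|] weightedShift θ t f := by
  rw [weightedShift_eq_ofTime_toTime]
  exact h.coeFn_ofTimeLp (coeFn_leftTranslation t (h.coeFn_toTimeLp hf))

/-- The weighted shift semigroup `(T_θ(t))_{t ≥ 0}`. -/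
def semigroup (h : IsTransportSpeed θ) : C0Semigroup (WeightedL2 (fun ξ => |θ ξ|)) where
  op := h.shiftLp
  op_zero := by
    ext x
    filter_upwards [h.coeFn_shiftLp 0 .rfl, ae_weightedMeasure_nonneg _] with ξ hx hξ
    exact hx.trans (h.weightedShift_zero x hξ)
  op_add s t := by
    ext x
    filter_upwards [h.coeFn_shiftLp (s + t) .rfl,
      h.coeFn_shiftLp s (h.coeFn_shiftLp t (f := x) .rfl), ae_weightedMeasure_nonneg _]
      with ξ hst hs hξ
    exact hst.trans ((h.weightedShift_add s.2 t.2 x hξ).trans hs.symm)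
  continuous_orbit x := h.ofTimeLp.continuous.comp
    ((continuous_leftTranslation (h.toTimeLp x)).comp NNReal.continuous_coe)

theorem ae_toTimeLp_travelTime (h : IsTransportSpeed θ) (x : WeightedL2 (fun ξ => |θ ξ|)) :
    ∀ᵐ ξ ∂weightedMeasure fun ξ => |θ ξ|, h.toTimeLp x (travelTime θ ξ) = θ ξ * x ξ := by
  filter_upwards [h.tendsto_travelTime_ae.eventually (ae_restrict_of_ae (h.coeFn_toTimeLp .rfl)),
    ae_weightedMeasure_nonneg _] with ξ hx hξ
  rw [hx, h.toTime_travelTime x hξ]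

theorem toTimeLp_ae_eq_zero (h : IsTransportSpeed θ) (x : WeightedL2 (fun ξ => |θ ξ|)) :
    ∀ᵐ s, 0 < s → h.toTimeLp x s = 0 := by
  filter_upwards [h.coeFn_toTimeLp (x := x) .rfl] with s hs hs0
  rw [hs, toTime_of_notMem x fun hsI => hs0.not_ge (h.travelRange_subset_Iic hsI)]

theorem toTimeLp_shiftLp (h : IsTransportSpeed θ) (t : ℝ≥0) (x : WeightedL2 (fun ξ => |θ ξ|)) :
    ∀ᵐ s, s ∈ travelRange θ → h.toTimeLp (h.shiftLp t x) s = h.toTimeLp x (s + t) := by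
  have hx := coeFn_leftTranslation t (h.coeFn_toTimeLp (x := x) .rfl)
  filter_upwards [h.coeFn_toTimeLp (h.coeFn_ofTimeLp hx),
    coeFn_leftTranslation t (g := h.toTimeLp x) .rfl, hx] with s hs hs' hx hsI
  rw [h.toTime_ofTime, indicator_of_mem hsI] at hs
  exact hs.trans (hx.symm.trans hs')

end IsTransportSpeed

section LineIntegrals

theorem tendsto_nnreal_coe_nhdsGT_zero :
    Tendsto (fun t : ℝ≥0 => (t : ℝ)) (𝓝[>] 0) (𝓝[>] 0) := by
  refine tendsto_nhdsWithin_iff.2 ⟨?_, ?_⟩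
  · exact (NNReal.continuous_coe.tendsto' 0 0 rfl).mono_left nhdsWithin_le_nhds
  · filter_upwards [self_mem_nhdsWithin] with t ht
    exact NNReal.coe_pos.2 ht

theorem locallyIntegrable_coeFn (g : Lp ℂ 2 (volume : Measure ℝ)) : LocallyIntegrable g volume :=
  (Lp.memLp g).locallyIntegrable one_le_two

theorem intervalIntegrable_coeFn (g : Lp ℂ 2 (volume : Measure ℝ)) (a b : ℝ) :
    IntervalIntegrable g volume a b :=
  ((locallyIntegrable_coeFn g).integrableOn_isCompact isCompact_uIcc).intervalIntegrable

theorem ae_eq_of_intervalIntegral_eq {E : Type*} [NormedAddCommGroup E] [NormedSpace ℝ E]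
    [CompleteSpace E] {f g : ℝ → E} {I : Set ℝ} {c : ℝ} (hI : I.OrdConnected) (hc : c ∈ I)
    (hf : LocallyIntegrable f volume) (hg : LocallyIntegrable g volume)
    (heq : ∀ a ∈ I, ∫ s in c..a, f s = ∫ s in c..a, g s) : ∀ᵐ s, s ∈ I → f s = g s := by
  filter_upwards [LocallyIntegrable.ae_hasDerivAt_integral hf,
    LocallyIntegrable.ae_hasDerivAt_integral hg, Measure.ae_ne volume c] with a hfa hga hne ha
  have huniq : UniqueDiffWithinAt ℝ (uIcc c a) a :=
    uniqueDiffOn_Icc (min_lt_max.2 hne.symm) a right_mem_uIcc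
  exact huniq.eq_deriv _ (hfa c).hasDerivWithinAt
    ((hga c).hasDerivWithinAt.congr (fun b hb => heq b (hI.uIcc_subset hc ha hb)) (heq a ha))

/-- The functional `g ↦ ∫_a^b g` on `L²(ℝ)`, for `a ≤ b`. -/
def intervalIntegralL2 (a b : ℝ) : Lp ℂ 2 (volume : Measure ℝ) →L[ℂ] ℂ :=
  innerSL ℂ (indicatorConstLp 2 (measurableSet_Ioc (a := a) (b := b)) measure_Ioc_lt_top.ne 1)

theorem intervalIntegralL2_apply {a b : ℝ} (hab : a ≤ b) (g : Lp ℂ 2 (volume : Measure ℝ)) :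
    intervalIntegralL2 a b g = ∫ s in a..b, g s := by
  rw [intervalIntegralL2, innerSL_apply_apply, L2.inner_indicatorConstLp_one,
    intervalIntegral.integral_of_le hab]

end LineIntegrals

theorem C0Semigroup.tendsto_of_op_sub_eq_integral {X : Type*} [NormedAddCommGroup X]
    [NormedSpace ℂ X] [CompleteSpace X] (T : C0Semigroup X) {x z : X}
    (hx : ∀ t : ℝ≥0, T.op t x - x = ∫ r in (0 : ℝ)..t, T.op r.toNNReal z) :
    Tendsto (fun t : ℝ≥0 => ((t : ℝ) : ℂ)⁻¹ • (T.op t x - x)) (𝓝[>] 0) (𝓝 z) := by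
  have horbit : Continuous fun r : ℝ => T.op r.toNNReal z :=
    (T.continuous_orbit z).comp continuous_real_toNNReal
  have hderiv : HasDerivAt (fun t : ℝ => ∫ r in (0 : ℝ)..t, T.op r.toNNReal z) z 0 := by
    simpa [T.op_zero] using (horbit.integral_hasStrictDerivAt 0 0).hasDerivAt
  have hlim := hderiv.tendsto_slope_zero_right.comp tendsto_nnreal_coe_nhdsGT_zero
  refine hlim.congr fun t => ?_
  simp [hx, ← Complex.ofReal_inv, Complex.coe_smul]

namespace IsTransportSpeed

variable {θ : ℝ → ℝ}

theorem integral_toTimeLp_of_nonneg (h : IsTransportSpeed θ) (x : WeightedL2 (fun ξ => |θ ξ|))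
    {t : ℝ} (ht : 0 ≤ t) : ∫ s in (0 : ℝ)..t, h.toTimeLp x s = 0 := by
  refine intervalIntegral.integral_zero_ae ?_
  filter_upwards [h.toTimeLp_ae_eq_zero x] with s hs hst
  rw [uIoc_of_le ht] at hst
  exact hs hst.1

theorem eq_of_integral_toTimeLp_eq (h : IsTransportSpeed θ) {x y : WeightedL2 (fun ξ => |θ ξ|)}
    (heq : ∀ a ∈ travelRange θ,
      intervalIntegralL2 a 0 (h.toTimeLp x) = intervalIntegralL2 a 0 (h.toTimeLp y)) : x = y := by
  have hint : ∀ a ∈ travelRange θ,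
      ∫ s in (0 : ℝ)..a, h.toTimeLp x s = ∫ s in (0 : ℝ)..a, h.toTimeLp y s := fun a ha => by
    have := heq a ha
    simp only [intervalIntegralL2_apply (h.travelRange_subset_Iic ha)] at this
    rw [intervalIntegral.integral_symm, this, ← intervalIntegral.integral_symm]
  have hflux := (ae_restrict_iff' h.measurableSet_travelRange).2
    (ae_eq_of_intervalIntegral_eq h.ordConnected_travelRange (zero_mem_travelRange θ)
      (locallyIntegrable_coeFn _) (locallyIntegrable_coeFn _) hint)
  ext
  filter_upwards [h.tendsto_travelTime_ae.eventually hflux, h.ae_toTimeLp_travelTime x,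
    h.ae_toTimeLp_travelTime y, ae_weightedMeasure_nonneg _] with ξ hxy hx hy hξ
  rw [hx, hy] at hxy
  exact mul_left_cancel₀ (Complex.ofReal_ne_zero.2 (h.neg ξ hξ).ne) hxy

theorem integral_toTimeLp_semigroup (h : IsTransportSpeed θ) (t : ℝ≥0)
    (x : WeightedL2 (fun ξ => |θ ξ|)) {a : ℝ} (ha : a ∈ travelRange θ) :
    intervalIntegralL2 a 0 (h.toTimeLp (h.semigroup.op t x)) =
      ∫ s in (a + t)..0, h.toTimeLp x s := by
  have ha0 : a ≤ 0 := h.travelRange_subset_Iic ha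
  have hshift : ∀ᵐ s, s ∈ uIoc a 0 → h.toTimeLp (h.semigroup.op t x) s = h.toTimeLp x (s + t) := by
    filter_upwards [h.toTimeLp_shiftLp t x] with s hs hsa
    rw [uIoc_of_le ha0] at hsa
    exact hs (h.Icc_subset_travelRange ha (Ioc_subset_Icc_self hsa))
  calc intervalIntegralL2 a 0 (h.toTimeLp (h.semigroup.op t x))
      = ∫ s in a..0, h.toTimeLp x (s + t) := by
        rw [intervalIntegralL2_apply ha0, intervalIntegral.integral_congr_ae hshift]
    _ = ∫ s in (a + t)..t, h.toTimeLp x s := by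
        rw [intervalIntegral.integral_comp_add_right (fun s => h.toTimeLp x s), zero_add]
    _ = ∫ s in (a + t)..0, h.toTimeLp x s := by
        rw [← intervalIntegral.integral_add_adjacent_intervals (intervalIntegrable_coeFn _ _ 0)
          (intervalIntegrable_coeFn _ _ _), h.integral_toTimeLp_of_nonneg x t.coe_nonneg, add_zero]

theorem ae_toTimeLp_eq_integral_of_tendsto (h : IsTransportSpeed θ)
    {x z : WeightedL2 (fun ξ => |θ ξ|)}
    (hlim : Tendsto (fun t : ℝ≥0 => ((t : ℝ) : ℂ)⁻¹ • (h.semigroup.op t x - x)) (𝓝[>] 0) (𝓝 z)) :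
    ∀ᵐ a, a ∈ travelRange θ → h.toTimeLp x a = ∫ s in (0 : ℝ)..a, h.toTimeLp z s := by
  filter_upwards [LocallyIntegrable.ae_hasDerivAt_integral (locallyIntegrable_coeFn (h.toTimeLp x))]
    with a hderiv ha
  have ha0 : a ≤ 0 := h.travelRange_subset_Iic ha
  have hint_lim := ((intervalIntegralL2 a 0).continuous.comp h.toTimeLp.continuous).tendsto z
    |>.comp hlim
  have hquot_lim := (hderiv 0).neg.tendsto_slope_zero_right.comp tendsto_nnreal_coe_nhdsGT_zero
  have hquot : ∀ t : ℝ≥0,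
      intervalIntegralL2 a 0 (h.toTimeLp (((t : ℝ) : ℂ)⁻¹ • (h.semigroup.op t x - x))) =
        (t : ℝ)⁻¹ • (-(∫ s in (0 : ℝ)..(a + t), h.toTimeLp x s) -
          -∫ s in (0 : ℝ)..a, h.toTimeLp x s) := fun t => by
    rw [map_smul, map_smul, map_sub, map_sub, h.integral_toTimeLp_semigroup t x ha,
      intervalIntegralL2_apply ha0, ← intervalIntegral.integral_symm,
      ← intervalIntegral.integral_symm, ← Complex.ofReal_inv, Complex.coe_smul]
  have hvalue : intervalIntegralL2 a 0 (h.toTimeLp z) = -h.toTimeLp x a :=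
    tendsto_nhds_unique (hint_lim.congr hquot) hquot_lim
  rw [intervalIntegral.integral_symm, ← intervalIntegralL2_apply ha0, hvalue, neg_neg]

theorem ae_toTimeLp_eq_integral_of_mem_Ioi (h : IsTransportSpeed θ)
    {x z : WeightedL2 (fun ξ => |θ ξ|)}
    (hxz : ∀ᵐ s, s ∈ travelRange θ → h.toTimeLp x s = ∫ r in (0 : ℝ)..s, h.toTimeLp z r)
    {a : ℝ} (ha : a ∈ travelRange θ) :
    ∀ᵐ s, a < s → h.toTimeLp x s = ∫ r in (0 : ℝ)..s, h.toTimeLp z r := by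
  filter_upwards [hxz, h.toTimeLp_ae_eq_zero x] with s hs hs_pos has
  obtain hs0 | hs0 := le_or_gt s 0
  · exact hs (h.Icc_subset_travelRange ha ⟨has.le, hs0⟩)
  · rw [hs_pos hs0, h.integral_toTimeLp_of_nonneg z hs0.le]

theorem semigroup_op_sub_eq_integral (h : IsTransportSpeed θ)
    {x z : WeightedL2 (fun ξ => |θ ξ|)}
    (hxz : ∀ᵐ s, s ∈ travelRange θ → h.toTimeLp x s = ∫ r in (0 : ℝ)..s, h.toTimeLp z r)
    (t : ℝ≥0) :
    h.semigroup.op t x - x = ∫ r in (0 : ℝ)..t, h.semigroup.op r.toNNReal z := by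
  have horbit : Continuous fun r : ℝ => h.semigroup.op r.toNNReal z :=
    (h.semigroup.continuous_orbit z).comp continuous_real_toNNReal
  refine h.eq_of_integral_toTimeLp_eq fun a ha => ?_
  have hprimitive : ∀ᵐ s, s ∈ uIoc a (a + t) →
      h.toTimeLp x s = -∫ r in s..0, h.toTimeLp z r := by
    filter_upwards [h.ae_toTimeLp_eq_integral_of_mem_Ioi hxz ha] with s hs hsa
    rw [uIoc_of_le (le_add_of_nonneg_right t.coe_nonneg)] at hsa
    rw [hs hsa.1, intervalIntegral.integral_symm]
  calc intervalIntegralL2 a 0 (h.toTimeLp (h.semigroup.op t x - x))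
      = (∫ s in (a + t)..0, h.toTimeLp x s) - ∫ s in a..0, h.toTimeLp x s := by
        rw [map_sub, map_sub, h.integral_toTimeLp_semigroup t x ha,
          intervalIntegralL2_apply (h.travelRange_subset_Iic ha)]
    _ = -∫ s in a..(a + t), h.toTimeLp x s := by
        rw [← intervalIntegral.integral_add_adjacent_intervals
          (intervalIntegrable_coeFn _ a (a + t)) (intervalIntegrable_coeFn _ _ 0)]
        ring
    _ = ∫ s in a..(a + t), ∫ r in s..0, h.toTimeLp z r := by
        rw [intervalIntegral.integral_congr_ae hprimitive, intervalIntegral.integral_neg, neg_neg]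
    _ = ∫ r in (0 : ℝ)..t, ∫ s in (a + r)..0, h.toTimeLp z s := by
        rw [intervalIntegral.integral_comp_add_left
          (fun s => ∫ r in s..0, h.toTimeLp z r), add_zero]
    _ = ∫ r in (0 : ℝ)..t, (intervalIntegralL2 a 0 ∘L h.toTimeLp)
          (h.semigroup.op r.toNNReal z) := by
        refine intervalIntegral.integral_congr fun r hr => ?_
        rw [uIcc_of_le t.coe_nonneg] at hr
        simp only [ContinuousLinearMap.comp_apply, h.integral_toTimeLp_semigroup _ z ha,
          Real.coe_toNNReal r hr.1]
    _ = intervalIntegralL2 a 0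
          (h.toTimeLp (∫ r in (0 : ℝ)..t, h.semigroup.op r.toNNReal z)) :=
        ContinuousLinearMap.intervalIntegral_comp_comm _ (horbit.intervalIntegrable 0 t)

theorem tendsto_semigroup_iff (h : IsTransportSpeed θ) {x z : WeightedL2 (fun ξ => |θ ξ|)} :
    Tendsto (fun t : ℝ≥0 => ((t : ℝ) : ℂ)⁻¹ • (h.semigroup.op t x - x)) (𝓝[>] 0) (𝓝 z) ↔
      ∀ᵐ s, s ∈ travelRange θ → h.toTimeLp x s = ∫ r in (0 : ℝ)..s, h.toTimeLp z r :=
  ⟨h.ae_toTimeLp_eq_integral_of_tendsto, fun hxz =>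
    h.semigroup.tendsto_of_op_sub_eq_integral (h.semigroup_op_sub_eq_integral hxz)⟩

end IsTransportSpeed

section AbsoluteContinuity

variable {E : Type*} [NormedAddCommGroup E] [NormedSpace ℝ E] {a b : ℝ}

theorem absolutelyContinuousOnInterval_of_dist_le {X Y : Type*} [PseudoMetricSpace X]
    [PseudoMetricSpace Y] {f : ℝ → X} {g : ℝ → Y} (hg : AbsolutelyContinuousOnInterval g a b)
    (hfg : ∀ s ∈ uIcc a b, ∀ t ∈ uIcc a b, dist (f s) (f t) ≤ dist (g s) (g t)) :
    AbsolutelyContinuousOnInterval f a b := by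
  rw [absolutelyContinuousOnInterval_iff] at hg ⊢
  intro ε hε
  obtain ⟨δ, hδ, hsum⟩ := hg ε hε
  refine ⟨δ, hδ, fun P hP hlen => (Finset.sum_le_sum fun i hi => ?_).trans_lt (hsum P hP hlen)⟩
  exact hfg _ (hP.1 i hi).1 _ (hP.1 i hi).2

theorem absolutelyContinuousOnInterval_integral {f : ℝ → E}
    (hf : IntervalIntegrable f volume a b) :
    AbsolutelyContinuousOnInterval (fun x => ∫ s in a..x, f s) a b := by
  refine absolutelyContinuousOnInterval_of_dist_le
    (hf.norm.absolutelyContinuousOnInterval_intervalIntegral left_mem_uIcc) fun s hs t ht => ?_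
  have hint : ∀ x ∈ uIcc a b, IntervalIntegrable f volume a x := fun x hx =>
    hf.mono_set (uIcc_subset_uIcc_left hx)
  rw [dist_eq_norm, dist_eq_norm,
    intervalIntegral.integral_interval_sub_left (hint s hs) (hint t ht),
    intervalIntegral.integral_interval_sub_left (hint s hs).norm (hint t ht).norm,
    Real.norm_eq_abs]
  exact intervalIntegral.norm_integral_le_abs_integral_norm

theorem integral_eq_sub_of_absolutelyContinuousOnInterval [CompleteSpace E] {f f' : ℝ → E}
    (hf : AbsolutelyContinuousOnInterval f a b) (hf' : IntervalIntegrable f' volume a b)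
    (hderiv : ∀ᵐ x, x ∈ uIcc a b → HasDerivAt f (f' x) x) :
    ∫ x in a..b, f' x = f b - f a := by
  obtain ⟨C, hC⟩ :=
    (hf.sub (absolutelyContinuousOnInterval_integral hf')).const_of_ae_hasDerivAt_zero (by
      filter_upwards [hderiv, IntervalIntegrable.ae_hasDerivAt_integral hf'] with x hfx hint hx
      simpa using (hfx hx).sub (hint hx a left_mem_uIcc))
  have ha : f a = C := by simpa using hC a left_mem_uIcc
  have hb : f b - ∫ x in a..b, f' x = C := hC b right_mem_uIcc
  rw [ha, ← hb, sub_sub_cancel]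

theorem ae_hasDerivAt_integral_Ici [CompleteSpace E] {f : ℝ → E}
    (hf : ∀ ξ, 0 ≤ ξ → IntervalIntegrable f volume 0 ξ) :
    ∀ᵐ ξ ∂volume.restrict (Ici (0 : ℝ)),
      HasDerivAt (fun ξ => ∫ ζ in (0 : ℝ)..ξ, f ζ) (f ξ) ξ := by
  rw [ae_restrict_iff' measurableSet_Ici]
  filter_upwards [ae_all_iff.2 fun n : ℕ =>
    IntervalIntegrable.ae_hasDerivAt_integral (hf n n.cast_nonneg)] with ξ hderiv hξ
  obtain ⟨n, hn⟩ := exists_nat_ge ξ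
  exact hderiv n (uIcc_of_le n.cast_nonneg (α := ℝ) ▸ ⟨hξ, hn⟩) 0 left_mem_uIcc

theorem locallyAC_integral {f : ℝ → ℂ} (hf : ∀ ξ, 0 ≤ ξ → IntervalIntegrable f volume 0 ξ) :
    LocallyAC (fun ξ => ∫ ζ in (0 : ℝ)..ξ, f ζ) (Ici 0) := by
  intro a b hab hI
  have ha : 0 ≤ a := hI ⟨le_rfl, hab⟩
  refine (absolutelyContinuousOnInterval_integral (hf b (ha.trans hab))).mono ?_
  rw [uIcc_of_le hab, uIcc_of_le (ha.trans hab)]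
  exact Icc_subset_Icc_left ha

end AbsoluteContinuity

theorem IsTransportRep.eq_integral_deriv {θ : ℝ → ℝ} {x : WeightedL2 (fun ξ => |θ ξ|)}
    {y : ℝ → ℂ} (hy : IsTransportRep θ x y) {ξ : ℝ} (hξ : 0 ≤ ξ)
    (hint : IntervalIntegrable (deriv y) volume 0 ξ) : y ξ = ∫ ζ in (0 : ℝ)..ξ, deriv y ζ := by
  have hderiv : ∀ᵐ ζ, ζ ∈ uIcc 0 ξ → HasDerivAt y (deriv y ζ) ζ := by
    filter_upwards [(ae_restrict_iff' measurableSet_Ici).1 hy.locallyAC.ae_differentiableAt]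
      with ζ hζ hmem
    rw [uIcc_of_le hξ] at hmem
    exact (hζ hmem.1).hasDerivAt
  rw [integral_eq_sub_of_absolutelyContinuousOnInterval
    (hy.locallyAC 0 ξ hξ Icc_subset_Ici_self) hint hderiv, hy.boundary, sub_zero]

namespace IsTransportSpeed

variable {θ : ℝ → ℝ} {x z : WeightedL2 (fun ξ => |θ ξ|)}

theorem mem_graph_transportOperator_iff_isTransportRep (h : IsTransportSpeed θ) :
    (x, z) ∈ (transportOperator θ h.continuousOn h.neg).graph ↔
      ∃ y, IsTransportRep θ x y ∧ z =ᵐ[weightedMeasure fun ξ => |θ ξ|] deriv y := by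
  rw [LinearPMap.mem_graph_iff]
  constructor
  · rintro ⟨⟨x, hx⟩, rfl, rfl⟩
    exact ⟨_, Classical.choose_spec hx, (Classical.choose_spec hx).memLp_deriv.coeFn_toLp⟩
  · rintro ⟨y, hy, hz⟩
    have hx : x ∈ transportDomain θ := ⟨y, hy⟩
    refine ⟨⟨x, hx⟩, rfl, Lp.ext ?_⟩
    exact (Classical.choose_spec hx).memLp_deriv.coeFn_toLp.trans
      (((Classical.choose_spec hx).deriv_ae_eq h.continuousOn h.neg hy).trans hz.symm)

theorem ae_abs_inv_smul_toTimeLp (h : IsTransportSpeed θ) (z : WeightedL2 (fun ξ => |θ ξ|))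
    (ξ : ℝ) : ∀ᵐ ζ ∂volume.restrict (Icc 0 ξ),
      |(θ ζ)⁻¹| • h.toTimeLp z (travelTime θ ζ) = -z ζ := by
  filter_upwards [ae_mono (Measure.restrict_mono Icc_subset_Ici_self le_rfl)
    (ae_of_ae_weightedMeasure h.continuousOn h.neg (h.ae_toTimeLp_travelTime z)),
    ae_restrict_mem measurableSet_Icc] with ζ hζ hmem
  have hne : (θ ζ : ℂ) ≠ 0 := Complex.ofReal_ne_zero.2 (h.neg ζ hmem.1).ne
  rw [hζ, abs_of_neg (h.inv.neg ζ hmem.1), Complex.real_smul, Complex.ofReal_neg,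
    Complex.ofReal_inv, neg_mul, inv_mul_cancel_left₀ hne]

theorem intervalIntegrable_weightedL2 (h : IsTransportSpeed θ)
    (z : WeightedL2 (fun ξ => |θ ξ|)) {ξ : ℝ} (hξ : 0 ≤ ξ) :
    IntervalIntegrable z volume 0 ξ := by
  have hflux : IntegrableOn (h.toTimeLp z) (travelTime θ '' Icc 0 ξ) := by
    rw [h.image_travelTime_Icc hξ]
    exact (locallyIntegrable_coeFn _).integrableOn_isCompact isCompact_Icc
  rw [integrableOn_image_iff_integrableOn_abs_deriv_smul measurableSet_Icc
    (fun ζ hζ => (h.hasDerivWithinAt_travelTime hζ.1).mono Icc_subset_Ici_self)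
    (h.strictAntiOn_travelTime.injOn.mono Icc_subset_Ici_self)] at hflux
  rw [intervalIntegrable_iff_integrableOn_Icc_of_le hξ]
  exact integrable_neg_iff.1 ((integrable_congr (h.ae_abs_inv_smul_toTimeLp z ξ)).1 hflux)

theorem integral_toTimeLp_travelTime (h : IsTransportSpeed θ)
    (z : WeightedL2 (fun ξ => |θ ξ|)) {ξ : ℝ} (hξ : 0 ≤ ξ) :
    ∫ s in (0 : ℝ)..travelTime θ ξ, h.toTimeLp z s = ∫ ζ in (0 : ℝ)..ξ, z ζ := by
  have hle : travelTime θ ξ ≤ 0 :=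
    h.travelRange_subset_Iic (travelTime_mem_travelRange θ hξ)
  rw [intervalIntegral.integral_symm, intervalIntegral.integral_of_le hle,
    ← integral_Icc_eq_integral_Ioc, ← h.image_travelTime_Icc hξ,
    integral_image_eq_integral_abs_deriv_smul measurableSet_Icc
      (fun ζ hζ => (h.hasDerivWithinAt_travelTime hζ.1).mono Icc_subset_Ici_self)
      (h.strictAntiOn_travelTime.injOn.mono Icc_subset_Ici_self),
    integral_congr_ae (h.ae_abs_inv_smul_toTimeLp z ξ), integral_neg, neg_neg,
    integral_Icc_eq_integral_Ioc, intervalIntegral.integral_of_le hξ]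

theorem mem_graph_transportOperator_iff (h : IsTransportSpeed θ) :
    (x, z) ∈ (transportOperator θ h.continuousOn h.neg).graph ↔
      ∀ᵐ ξ ∂weightedMeasure fun ξ => |θ ξ|, θ ξ * x ξ = ∫ ζ in (0 : ℝ)..ξ, z ζ := by
  rw [h.mem_graph_transportOperator_iff_isTransportRep]
  have hint : ∀ ξ, 0 ≤ ξ → IntervalIntegrable z volume 0 ξ := fun _ =>
    h.intervalIntegrable_weightedL2 z
  constructor
  · rintro ⟨y, hy, hzy⟩
    have hzy' := ae_of_ae_weightedMeasure h.continuousOn h.neg hzy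
    filter_upwards [hy.ae_eq, ae_weightedMeasure_nonneg _] with ξ hyξ hξ
    have hzyξ : z =ᵐ[volume.restrict (uIoc 0 ξ)] deriv y := by
      refine ae_mono (Measure.restrict_mono ?_ le_rfl) hzy'
      rw [uIoc_of_le hξ]
      exact Ioc_subset_Icc_self.trans Icc_subset_Ici_self
    rw [← hyξ, hy.eq_integral_deriv hξ ((hint ξ hξ).congr_ae hzyξ),
      intervalIntegral.integral_congr_ae_restrict hzyξ]
  · intro hxz
    have hderiv : deriv (fun ξ => ∫ ζ in (0 : ℝ)..ξ, z ζ) =ᵐ[weightedMeasure fun ξ => |θ ξ|] z :=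
      ae_weightedMeasure_of_ae ((ae_hasDerivAt_integral_Ici hint).mono fun _ hξ => hξ.deriv)
    refine ⟨_, ⟨?_, locallyAC_integral hint, (memLp_congr_ae hderiv).2 (Lp.memLp z),
      intervalIntegral.integral_same⟩, hderiv.symm⟩
    filter_upwards [hxz] with ξ hξ using hξ.symm

theorem isGenerator_transportOperator (h : IsTransportSpeed θ) :
    IsGenerator (transportOperator θ h.continuousOn h.neg) h.semigroup := by
  intro x z
  rw [h.mem_graph_transportOperator_iff, h.tendsto_semigroup_iff,
    ← ae_restrict_iff' h.measurableSet_travelRange, h.ae_travelRange_iff]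
  refine eventually_congr ?_
  filter_upwards [h.ae_toTimeLp_travelTime x, ae_weightedMeasure_nonneg _] with ξ hx hξ
  rw [hx, h.integral_toTimeLp_travelTime z hξ]

end IsTransportSpeed

theorem proposition4p3_general (θ : ℝ → ℝ) (hθ : ContinuousOn θ (Ici 0))
    (hneg : ∀ ξ, 0 ≤ ξ → θ ξ < 0) :
    ∃ T : C0Semigroup (WeightedL2 (fun ξ => |θ ξ|)),
      IsGenerator (transportOperator θ hθ hneg) T ∧
      ∀ (t : ℝ≥0) (x : WeightedL2 (fun ξ => |θ ξ|)) (f : ℝ → ℂ),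
        f =ᵐ[weightedMeasure fun ξ => |θ ξ|] x →
          T.op t x =ᵐ[weightedMeasure fun ξ => |θ ξ|] weightedShift θ t f :=
  have h : IsTransportSpeed θ := ⟨hθ, hneg⟩
  ⟨h.semigroup, h.isGenerator_transportOperator, fun t _ _ hf => h.coeFn_shiftLp t hf.symm⟩

end

theorem proposition4p3 (θ : ℝ → ℝ) (hθ : ContinuousOn θ (Ici 0))
    (hneg : ∀ ξ, 0 ≤ ξ → θ ξ < 0)
    (hint : ¬ IntegrableOn (fun ξ => 1 / θ ξ) (Ioi 0) volume) :
    ∃ T : C0Semigroup (WeightedL2 (fun ξ => |θ ξ|)),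
      IsGenerator (transportOperator θ hθ hneg) T ∧
      ∀ (t : ℝ≥0) (x : WeightedL2 (fun ξ => |θ ξ|)) (f : ℝ → ℂ),
        f =ᵐ[weightedMeasure fun ξ => |θ ξ|] x →
          T.op t x =ᵐ[weightedMeasure fun ξ => |θ ξ|] weightedShift θ t f :=
  proposition4p3_general θ hθ hneg
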